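/- For $n\ge 0$ let $SG_{2,3}(n)$ be the following finite graph. $SG_{2,3}(0)$ is an equilateral triangle (three vertices, pairwise joined by edges). For $n\ge 0$, $SG_{2,3}(n+1)$ is the union of six copies of $SG_{2,3}(n)$, each occupying an upward-pointing triangle of side $3^n$, arranged in three layers (of three, two and one copies) to form an upward-pointing triangle of side $3^{n+1}$; adjacent copies share a corner vertex, and these are the only identifications. Let $N_{SF}(G)$ be the number of spanning forests of a finite graph $G$, i.e. of acyclic subgraphs of $G$ with the same vertex set as $G$, and let $v(G)$ be the number of vertices of $G$. Then the asymptotic growth constant $$z_{SG_{2,3}}=\lim_{n\to\infty}\frac{\ln N_{SF}(SG_{2,3}(n))}{v(SG_{2,3}(n))}$$ exists, and $z_{SG_{2,3}}=1.31235755933\ldots$, i.e. $1.31235755933\le z_{SG_{2,3}}<1.31235755934$. -/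

import Mathlib

/-- Positions of the `b (b + 1) / 2` copies that make up the next stage of the gasket:
the pairs `(i, j)` of natural numbers with `i + j < b`. -/
def gasketCells (b : ℕ) : Finset (ℕ × ℕ) :=
  (Finset.range b ×ˢ Finset.range b).filter fun c => c.1 + c.2 < b

/-- The vertex set of the two-dimensional generalized Sierpinski gasket with side length `b` at
stage `n`. The pair `(x, y)` stands for the point `x • u + y • v` of the plane, where `u` and `v`
are unit vectors at an angle of 60 degrees. Stage `0` is an equilateral triangle of side `1`;
stage `n` is contained in a triangle of side `b ^ n`, and stage `n + 1` is the union of the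
translates of stage `n` that are arranged in `b` layers; translates share corner vertices only. -/
def gasketVerts (b : ℕ) : ℕ → Finset (ℕ × ℕ)
  | 0 => {(0, 0), (1, 0), (0, 1)}
  | n + 1 => (gasketCells b).biUnion fun c =>
      (gasketVerts b n).image fun p => b ^ n • c + p

/-- The edges of the gasket at stage `n`, as a graph on the ambient lattice: at stage `0` the three
sides of the triangle, at stage `n + 1` the edges of all translates of stage `n`. -/
def gasketEdges (b : ℕ) : ℕ → SimpleGraph (ℕ × ℕ)
  | 0 => SimpleGraph.fromRel fun p q => p ∈ gasketVerts b 0 ∧ q ∈ gasketVerts b 0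
  | n + 1 => ⨆ c ∈ gasketCells b,
      (gasketEdges b n).map fun p => b ^ n • c + p

/-- The two-dimensional generalized Sierpinski gasket with side length `b` at stage `n`,
as a graph on its finite vertex set (every edge of `gasketEdges b n` joins two of its vertices). -/
def gasket (b n : ℕ) : SimpleGraph (gasketVerts b n) :=
  SimpleGraph.comap Subtype.val (gasketEdges b n)

/-- The number of spanning forests of a (finite) graph: the number of acyclic subgraphs that have
the same vertex set. -/
noncomputable def numSpanningForests {V : Type*} (G : SimpleGraph V) : ℕ :=
  {F : SimpleGraph V | F ≤ G ∧ F.IsAcyclic}.ncard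

/-- `z` is the asymptotic growth constant for the number of spanning forests on the
two-dimensional generalized Sierpinski gasket with side length `b`. -/
def IsForestGrowthConstant (b : ℕ) (z : ℝ) : Prop :=
  Filter.Tendsto
    (fun n : ℕ => Real.log (numSpanningForests (gasket b n)) / ((gasketVerts b n).card : ℝ))
    Filter.atTop (nhds z)

/-! Sort the spanning forests of a stage by how their components partition the three outer corners:
all separated, exactly one pair together (three ways), or all together. Up to acyclicity and
connectivity between corners, a forest inside a copy can be replaced by any other forest of the same
type (`edgeGraph_exchange`, `sum_piece`). Hence the five counts at stage n + 1 are fixed homogeneous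
polynomials of degree 6 in the five counts at stage n (`typeCount_succ`), and these can be evaluated
by tracking a labelling of the ten mesh points while the six copies are glued in turn.

Two inequalities follow. A forest at stage n + 1 restricts to a forest in each copy, so the total F
satisfies F(n + 1) ≤ F(n) ^ 6. Six forests with separated corners glue to one with separated
corners, so the separated count A satisfies A(n) ^ 6 ≤ A(n + 1). Thus log A(n) / 6 ^ n increases,
log F(n) / 6 ^ n decreases, and every value of the first is at most every value of the second. The
second sequence converges to its infimum; whether the two limits agree is not needed.

Since 5 v(n) = 7 * 6 ^ n + 8, the growth constant is 5 / 7 times that infimum. The exact counts at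
stage 3 and the leading digits of A(4) already confine it to the claimed interval. -/

open SimpleGraph

/-! ### Acyclicity and reachability of finite edge sets -/

section Glue

variable {V : Type*} [DecidableEq V]

/-- The graph with a given finite set of edges. -/
abbrev edgeGraph (S : Finset (Sym2 V)) : SimpleGraph V := fromEdgeSet (S : Set (Sym2 V))

omit [DecidableEq V] in
lemma reachable_sup_edge_iff (G : SimpleGraph V) (x y u v : V) :
    (G ⊔ edge x y).Reachable u v ↔ G.Reachable u v ∨ (G.Reachable u x ∧ G.Reachable y v) ∨
      (G.Reachable u y ∧ G.Reachable x v) := by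
  have hle : G ≤ G ⊔ edge x y := le_sup_left
  have hxy : (G ⊔ edge x y).Reachable x y := by
    by_cases h : x = y
    · exact h ▸ Reachable.refl _
    · exact Adj.reachable (by simp [edge_adj, h])
  constructor
  · intro h
    rw [reachable_iff_reflTransGen] at h
    induction h with
    | refl => exact Or.inl (Reachable.refl _)
    | @tail b c _ hbc ih =>
      rcases hbc with hbc | hbc
      · have hbc := hbc.reachable
        rcases ih with h | ⟨h, h'⟩ | ⟨h, h'⟩
        · exact Or.inl (h.trans hbc)
        · exact Or.inr (Or.inl ⟨h, h'.trans hbc⟩)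
        · exact Or.inr (Or.inr ⟨h, h'.trans hbc⟩)
      · rw [edge_adj] at hbc
        obtain ⟨⟨rfl, rfl⟩ | ⟨rfl, rfl⟩, -⟩ := hbc
        · rcases ih with h | ⟨h, h'⟩ | ⟨h, h'⟩
          · exact Or.inr (Or.inl ⟨h, Reachable.refl _⟩)
          · exact Or.inr (Or.inl ⟨h, Reachable.refl _⟩)
          · exact Or.inl h
        · rcases ih with h | ⟨h, h'⟩ | ⟨h, h'⟩
          · exact Or.inr (Or.inr ⟨h, Reachable.refl _⟩)
          · exact Or.inl h
          · exact Or.inr (Or.inr ⟨h, Reachable.refl _⟩)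
  · rintro (h | ⟨h, h'⟩ | ⟨h, h'⟩)
    · exact h.mono hle
    · exact ((h.mono hle).trans hxy).trans (h'.mono hle)
    · exact ((h.mono hle).trans hxy.symm).trans (h'.mono hle)

lemma edgeGraph_insert (S : Finset (Sym2 V)) (x y : V) :
    edgeGraph (insert s(x, y) S) = edgeGraph S ⊔ edge x y := by
  rw [edgeGraph, edgeGraph, edge, ← fromEdgeSet_union, Finset.coe_insert, Set.union_singleton]

lemma edgeGraph_insert_isAcyclic {S : Finset (Sym2 V)} {x y : V} (hS : s(x, y) ∉ S)
    (hxy : x ≠ y) : (edgeGraph (insert s(x, y) S)).IsAcyclic ↔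
      (edgeGraph S).IsAcyclic ∧ ¬ (edgeGraph S).Reachable x y := by
  rw [edgeGraph_insert, isAcyclic_sup_fromEdgeSet_iff]
  simp [hxy, hS]

lemma edgeGraph_insert_reachable (S : Finset (Sym2 V)) (x y u v : V) :
    (edgeGraph (insert s(x, y) S)).Reachable u v ↔ (edgeGraph S).Reachable u v ∨
      ((edgeGraph S).Reachable u x ∧ (edgeGraph S).Reachable y v) ∨
      ((edgeGraph S).Reachable u y ∧ (edgeGraph S).Reachable x v) := by
  rw [edgeGraph_insert, reachable_sup_edge_iff]

omit [DecidableEq V] in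
lemma edgeGraph_empty : edgeGraph (∅ : Finset (Sym2 V)) = ⊥ := by simp [edgeGraph]

/-- Injective images of edge sets have the same acyclicity and connectivity. -/
lemma edgeGraph_image {V' : Type*} [DecidableEq V'] (f : V → V') (hf : f.Injective)
    (S : Finset (Sym2 V)) (hS : ∀ e ∈ S, ¬ e.IsDiag) :
    ((edgeGraph (S.image (Sym2.map f))).IsAcyclic ↔ (edgeGraph S).IsAcyclic) ∧
      ∀ x y, (edgeGraph (S.image (Sym2.map f))).Reachable (f x) (f y) ↔
        (edgeGraph S).Reachable x y := by
  induction S using Finset.induction_on with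
  | empty => simp [edgeGraph_empty, reachable_bot, hf.eq_iff]
  | insert e S he ih =>
    obtain ⟨ih1, ih2⟩ := ih fun e h => hS e (Finset.mem_insert_of_mem h)
    have hd := hS e (Finset.mem_insert_self _ _)
    induction e with | h x y
    rw [Sym2.mk_isDiag_iff] at hd
    have hni : s(f x, f y) ∉ S.image (Sym2.map f) := by
      rw [← Sym2.map_mk, (Sym2.map.injective hf).mem_finset_image]
      exact he
    rw [Finset.image_insert, Sym2.map_mk]
    refine ⟨?_, fun u v => ?_⟩
    · rw [edgeGraph_insert_isAcyclic hni (hf.ne hd), edgeGraph_insert_isAcyclic he hd, ih1, ih2]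
    · rw [edgeGraph_insert_reachable, edgeGraph_insert_reachable]
      simp only [ih2]

/-- Replacing an edge set by one with the same connectivity between the vertices in `W` does not
change acyclicity and connectivity when further edges inside `W` are added. -/
lemma edgeGraph_exchange {A B B' : Finset (Sym2 V)} {W : Set V}
    (hA : ∀ x y, s(x, y) ∈ A → x ∈ W ∧ y ∈ W ∧ x ≠ y)
    (hB : Disjoint A B) (hB' : Disjoint A B')
    (hac : (edgeGraph B).IsAcyclic ↔ (edgeGraph B').IsAcyclic)
    (hr : ∀ x ∈ W, ∀ y ∈ W, (edgeGraph B).Reachable x y ↔ (edgeGraph B').Reachable x y) :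
    ((edgeGraph (A ∪ B)).IsAcyclic ↔ (edgeGraph (A ∪ B')).IsAcyclic) ∧
      ∀ x ∈ W, ∀ y ∈ W,
        (edgeGraph (A ∪ B)).Reachable x y ↔ (edgeGraph (A ∪ B')).Reachable x y := by
  -- Whether an edge closes a cycle, and which components it merges, depends only on reachability
  -- from its ends. These lie in `W`, so agreement on `W` survives each added edge.
  induction A using Finset.induction_on with
  | empty => simpa using ⟨hac, hr⟩
  | insert e A he ih =>
    rw [Finset.disjoint_insert_left] at hB hB'
    obtain ⟨ih1, ih2⟩ := ih (fun x y h => hA x y (Finset.mem_insert_of_mem h)) hB.2 hB'.2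
    induction e with | h x y
    obtain ⟨hx, hy, hxy⟩ := hA x y (Finset.mem_insert_self _ _)
    rw [Finset.insert_union, Finset.insert_union]
    refine ⟨?_, fun u hu v hv => ?_⟩
    · rw [edgeGraph_insert_isAcyclic (by simp [he, hB.1]) hxy,
        edgeGraph_insert_isAcyclic (by simp [he, hB'.1]) hxy, ih1, ih2 x hx y hy]
    · rw [edgeGraph_insert_reachable, edgeGraph_insert_reachable, ih2 u hu v hv, ih2 u hu x hx,
        ih2 y hy v hv, ih2 u hu y hy, ih2 x hx v hv]

omit [DecidableEq V] in
lemma edgeGraph_reachable_of_notMem {B : Finset (Sym2 V)} {U : Set V}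
    (hB : ∀ x y, s(x, y) ∈ B → x ∈ U ∧ y ∈ U) {x y : V} (hx : x ∉ U) :
    (edgeGraph B).Reachable x y ↔ x = y := by
  refine ⟨fun h => ?_, fun h => h ▸ Reachable.refl _⟩
  by_contra hne
  obtain ⟨z, hz⟩ := h.nonempty_neighborSet_left hne
  rw [mem_neighborSet, fromEdgeSet_adj] at hz
  exact hx (hB _ _ (by simpa using hz.1)).1

-- Points outside `U` are isolated in both graphs. Agreement on the corners `T` therefore extends to
-- every point that is not a non-corner point of the cell.
omit [DecidableEq V] in
lemma edgeGraph_reachable_congr {B B' : Finset (Sym2 V)} {U T : Set V}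
    (hB : ∀ x y, s(x, y) ∈ B → x ∈ U ∧ y ∈ U) (hB' : ∀ x y, s(x, y) ∈ B' → x ∈ U ∧ y ∈ U)
    (hr : ∀ x ∈ T, ∀ y ∈ T, (edgeGraph B).Reachable x y ↔ (edgeGraph B').Reachable x y)
    {x y : V} (hx : x ∈ U → x ∈ T) (hy : y ∈ U → y ∈ T) :
    (edgeGraph B).Reachable x y ↔ (edgeGraph B').Reachable x y := by
  by_cases hxU : x ∈ U
  · by_cases hyU : y ∈ U
    · exact hr x (hx hxU) y (hy hyU)
    · rw [reachable_comm, edgeGraph_reachable_of_notMem hB hyU, reachable_comm,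
        edgeGraph_reachable_of_notMem hB' hyU]
  · rw [edgeGraph_reachable_of_notMem hB hxU, edgeGraph_reachable_of_notMem hB' hxU]

end Glue

lemma sum_powerset_union {α M : Type*} [DecidableEq α] [AddCommMonoid M] {s t : Finset α}
    (h : Disjoint s t) (f : Finset α → M) :
    ∑ S ∈ (s ∪ t).powerset, f S = ∑ A ∈ s.powerset, ∑ B ∈ t.powerset, f (A ∪ B) := by
  rw [← Finset.sum_product']
  symm
  refine Finset.sum_nbij' (fun p => p.1 ∪ p.2) (fun S => (S ∩ s, S ∩ t)) ?_ ?_ ?_ ?_ ?_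
  · rintro ⟨A, B⟩ hAB
    simp only [Finset.mem_product, Finset.mem_powerset] at hAB ⊢
    exact Finset.union_subset_union hAB.1 hAB.2
  · intro S _
    simp [Finset.inter_subset_right]
  · rintro ⟨A, B⟩ hAB
    simp only [Finset.mem_product, Finset.mem_powerset] at hAB
    have h1 := h.mono_left hAB.1
    have h2 := h.mono_right hAB.2
    rw [Finset.disjoint_iff_inter_eq_empty] at h1 h2
    ext1
    · simp [Finset.union_inter_distrib_right, Finset.inter_eq_left.2 hAB.1, Finset.inter_comm B, h2]
    · simp [Finset.union_inter_distrib_right, Finset.inter_eq_left.2 hAB.2, h1]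
  · intro S hS
    rw [Finset.mem_powerset] at hS
    simp [← Finset.inter_union_distrib_left, Finset.inter_eq_left.2 hS]
  · simp

/-! ### Computable gluing sums and their meaning in terms of forests -/

/-- Merge the classes of `i` and `j` in a labelling of `ℕ` by classes. -/
def mergeLabels (i j : ℕ) (lab : ℕ → ℕ) : ℕ → ℕ :=
  fun k => bif (lab k).beq (lab j) then lab i else lab k

/-- Apply `f` to the labelling with the classes of `i` and `j` merged; the value is `0` if they
agree already, that is, if an edge between `i` and `j` closes a cycle. -/
def joinThen (i j : ℕ) (lab : ℕ → ℕ) (f : (ℕ → ℕ) → ℕ) : ℕ :=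
  bif (lab i).beq (lab j) then 0 else f (mergeLabels i j lab)

/-- The way in which a labelling partitions three indices: `0` if they are separated, `1`, `2`, `3`
if only `b, c`, only `a, c` or only `a, b` are together, `4` if all three are together. -/
def labelType (a b c : ℕ) (lab : ℕ → ℕ) : ℕ :=
  bif (lab a).beq (lab b) then (bif (lab a).beq (lab c) then 4 else 3) else
  bif (lab a).beq (lab c) then 2 else bif (lab b).beq (lab c) then 1 else 0

/-- The weighted number of ways to glue the triangular cells of a list, each with one of the five
connectivity types of weights `w₀, …, w₄`, without closing a cycle; the outcomes are weighted
by `φ`. -/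
def glueSum (w₀ w₁ w₂ w₃ w₄ : ℕ) (φ : (ℕ → ℕ) → ℕ) : List (ℕ × ℕ × ℕ) → (ℕ → ℕ) → ℕ
  | [], lab => φ lab
  | (a, b, c) :: cs, lab =>
    w₀ * glueSum w₀ w₁ w₂ w₃ w₄ φ cs lab
    + w₁ * joinThen b c lab (glueSum w₀ w₁ w₂ w₃ w₄ φ cs)
    + w₂ * joinThen a c lab (glueSum w₀ w₁ w₂ w₃ w₄ φ cs)
    + w₃ * joinThen a b lab (glueSum w₀ w₁ w₂ w₃ w₄ φ cs)
    + w₄ * joinThen a b lab fun lab' => joinThen a c lab' (glueSum w₀ w₁ w₂ w₃ w₄ φ cs)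

/-- The number of ways to add edges of a list without closing a cycle, the outcomes being
weighted by `φ`. -/
def edgeSum (φ : (ℕ → ℕ) → ℕ) : List (ℕ × ℕ) → (ℕ → ℕ) → ℕ
  | [], lab => φ lab
  | (i, j) :: es, lab => edgeSum φ es lab + joinThen i j lab (edgeSum φ es)

/-- The definitions use `bif` and `Nat.beq` to suit kernel evaluation; this and the next two lemmas
give the `if` forms used for reasoning. -/
lemma mergeLabels_apply (i j : ℕ) (lab : ℕ → ℕ) (k : ℕ) :
    mergeLabels i j lab k = if lab k = lab j then lab i else lab k := by
  simp [mergeLabels, Bool.cond_eq_ite]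

lemma joinThen_eq (i j : ℕ) (lab : ℕ → ℕ) (f : (ℕ → ℕ) → ℕ) :
    joinThen i j lab f = if lab i = lab j then 0 else f (mergeLabels i j lab) := by
  simp [joinThen, Bool.cond_eq_ite]

lemma labelType_eq (a b c : ℕ) (lab : ℕ → ℕ) : labelType a b c lab =
    if lab a = lab b then (if lab a = lab c then 4 else 3) else
    if lab a = lab c then 2 else if lab b = lab c then 1 else 0 := by
  simp [labelType, Bool.cond_eq_ite]

section Semantics

variable {V : Type*}

open Classical in
/-- The way in which the components of a graph partition three vertices, coded as in
`labelType`. -/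
noncomputable def connType (G : SimpleGraph V) (a b c : V) : ℕ :=
  if G.Reachable a b then (if G.Reachable a c then 4 else 3) else
  if G.Reachable a c then 2 else if G.Reachable b c then 1 else 0

open Classical in
/-- The indicator of a graph being a forest of type `t` with respect to three vertices. -/
noncomputable def forestInd (a b c : V) (t : ℕ) (G : SimpleGraph V) : ℕ :=
  if G.IsAcyclic ∧ connType G a b c = t then 1 else 0

lemma connType_lt (G : SimpleGraph V) (a b c : V) : connType G a b c < 5 := by
  unfold connType; split_ifs <;> norm_num

lemma reachable_of_connType_eq {G H : SimpleGraph V} {a b c : V}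
    (h : connType G a b c = connType H a b c) :
    (G.Reachable a b ↔ H.Reachable a b) ∧ (G.Reachable a c ↔ H.Reachable a c) ∧
      (G.Reachable b c ↔ H.Reachable b c) := by
  -- Transitivity rules out exactly two of the three pairs being connected, so the five codes
  -- determine all three relations.
  have g1 : G.Reachable a b → G.Reachable a c → G.Reachable b c := fun h h' => h.symm.trans h'
  have g2 : G.Reachable a b → G.Reachable b c → G.Reachable a c := fun h h' => h.trans h'
  have g3 : G.Reachable a c → G.Reachable b c → G.Reachable a b := fun h h' => h.trans h'.symm
  have h1 : H.Reachable a b → H.Reachable a c → H.Reachable b c := fun h h' => h.symm.trans h'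
  have h2 : H.Reachable a b → H.Reachable b c → H.Reachable a c := fun h h' => h.trans h'
  have h3 : H.Reachable a c → H.Reachable b c → H.Reachable a b := fun h h' => h.trans h'.symm
  unfold connType at h
  grind

lemma connType_congr {V' : Type*} {G : SimpleGraph V} {H : SimpleGraph V'} {a b c : V}
    {a' b' c' : V'} (h₁ : G.Reachable a b ↔ H.Reachable a' b')
    (h₂ : G.Reachable a c ↔ H.Reachable a' c') (h₃ : G.Reachable b c ↔ H.Reachable b' c') :
    connType G a b c = connType H a' b' c' := by
  unfold connType
  split_ifs <;> tauto

lemma forestInd_congr {V' : Type*} {G : SimpleGraph V} {H : SimpleGraph V'} {a b c : V}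
    {a' b' c' : V'} {t : ℕ} (h₀ : G.IsAcyclic ↔ H.IsAcyclic)
    (h₁ : G.Reachable a b ↔ H.Reachable a' b') (h₂ : G.Reachable a c ↔ H.Reachable a' c')
    (h₃ : G.Reachable b c ↔ H.Reachable b' c') :
    forestInd a b c t G = forestInd a' b' c' t H := by
  unfold forestInd
  rw [connType_congr h₁ h₂ h₃]
  split_ifs <;> tauto

lemma reachable_iff_of_mem {G H : SimpleGraph V} {a b c : V}
    (h : connType G a b c = connType H a b c) {x y : V} (hx : x = a ∨ x = b ∨ x = c)
    (hy : y = a ∨ y = b ∨ y = c) : G.Reachable x y ↔ H.Reachable x y := by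
  obtain ⟨h1, h2, h3⟩ := reachable_of_connType_eq h
  rcases hx with rfl | rfl | rfl <;> rcases hy with rfl | rfl | rfl <;>
    first
    | assumption
    | exact ⟨fun _ => Reachable.refl _, fun _ => Reachable.refl _⟩
    | (rw [reachable_comm, reachable_comm (G := H)]; assumption)

variable [DecidableEq V]

/-- A forest with the prescribed partition of three vertices that has no other edges. -/
def typeEdges (a b c : V) : ℕ → Finset (Sym2 V)
  | 0 => ∅
  | 1 => {s(b, c)}
  | 2 => {s(a, c)}
  | 3 => {s(a, b)}
  | _ => {s(a, c), s(a, b)}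

lemma edgeGraph_singleton_isAcyclic {x y : V} (h : x ≠ y) :
    (edgeGraph {s(x, y)}).IsAcyclic := by
  rw [← insert_empty_eq, edgeGraph_insert_isAcyclic (Finset.notMem_empty _) h]
  simp [edgeGraph_empty, reachable_bot, h]

lemma edgeGraph_singleton_reachable (x y u v : V) :
    (edgeGraph {s(x, y)}).Reachable u v ↔ u = v ∨ (u = x ∧ y = v) ∨ (u = y ∧ x = v) := by
  rw [← insert_empty_eq, edgeGraph_insert_reachable]
  simp [edgeGraph_empty, reachable_bot]

lemma typeEdges_spec {a b c : V} (hab : a ≠ b) (hac : a ≠ c) (hbc : b ≠ c) {t : ℕ} (ht : t < 5) :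
    (edgeGraph (typeEdges a b c t)).IsAcyclic ∧
      connType (edgeGraph (typeEdges a b c t)) a b c = t := by
  have hne : s(a, c) ∉ ({s(a, b)} : Finset (Sym2 V)) := by
    simp [hab, hbc.symm]
  interval_cases t
  · simp [typeEdges, connType, edgeGraph_empty, reachable_bot, hab, hac, hbc]
  · refine ⟨edgeGraph_singleton_isAcyclic hbc, ?_⟩
    simp [typeEdges, connType, edgeGraph_singleton_reachable, hab, hac]
  · refine ⟨edgeGraph_singleton_isAcyclic hac, ?_⟩
    simp [typeEdges, connType, edgeGraph_singleton_reachable, hab, hbc.symm]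
  · refine ⟨edgeGraph_singleton_isAcyclic hab, ?_⟩
    simp [typeEdges, connType, edgeGraph_singleton_reachable, hbc, hac]
  · refine ⟨?_, ?_⟩
    · change (edgeGraph {s(a, c), s(a, b)}).IsAcyclic
      rw [edgeGraph_insert_isAcyclic hne hac, edgeGraph_singleton_reachable]
      exact ⟨edgeGraph_singleton_isAcyclic hab, by simp [hac, hbc, hab]⟩
    · simp [typeEdges, connType, edgeGraph_insert_reachable, edgeGraph_singleton_reachable]

/-- A labelling describes the partition of the vertices `e i` into the components of a forest. -/
def Labels (e : ℕ → V) (B : Finset (Sym2 V)) (lab : ℕ → ℕ) : Prop :=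
  (edgeGraph B).IsAcyclic ∧ ∀ i j, (edgeGraph B).Reachable (e i) (e j) ↔ lab i = lab j

lemma Labels.insert_edge {e : ℕ → V} {B : Finset (Sym2 V)} {lab : ℕ → ℕ} (h : Labels e B lab) {i j : ℕ}
    (hB : s(e i, e j) ∉ B) (hij : e i ≠ e j) (hl : lab i ≠ lab j) :
    Labels e (insert s(e i, e j) B) (mergeLabels i j lab) := by
  refine ⟨(edgeGraph_insert_isAcyclic hB hij).2 ⟨h.1, by rwa [h.2]⟩, fun u v => ?_⟩
  rw [edgeGraph_insert_reachable]
  simp only [h.2, mergeLabels_apply]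
  grind

lemma Labels.sum_insert {e : ℕ → V} {B : Finset (Sym2 V)} {lab : ℕ → ℕ} (h : Labels e B lab)
    {i j : ℕ} (hB : s(e i, e j) ∉ B) (hij : e i ≠ e j) (a b c : V) (t : ℕ)
    (E : Finset (Sym2 V)) (f : (ℕ → ℕ) → ℕ)
    (hf : ∀ lab', Labels e (insert s(e i, e j) B) lab' →
      ∑ S ∈ E.powerset, forestInd a b c t (edgeGraph (S ∪ insert s(e i, e j) B)) = f lab') :
    ∑ S ∈ E.powerset, forestInd a b c t (edgeGraph (S ∪ insert s(e i, e j) B)) =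
      joinThen i j lab f := by
  rw [joinThen_eq]
  split_ifs with hl
  -- The new edge already closes a cycle, and no larger edge set is acyclic: this is the default
  -- value 0 of `joinThen`.
  · refine Finset.sum_eq_zero fun S _ => if_neg fun hS => ?_
    have := hS.1.anti (fromEdgeSet_mono (Finset.coe_subset.2 Finset.subset_union_right))
    exact ((edgeGraph_insert_isAcyclic hB hij).1 this).2 ((h.2 i j).2 hl)
  · exact hf _ (h.insert_edge hB hij hl)

end Semantics

/-- The indicator of labellings that partition three indices in a prescribed way. -/
def typeInd (a b c t : ℕ) (lab : ℕ → ℕ) : ℕ := bif (labelType a b c lab).beq t then 1 else 0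

lemma typeInd_eq (a b c t : ℕ) (lab : ℕ → ℕ) :
    typeInd a b c t lab = if labelType a b c lab = t then 1 else 0 := by
  simp [typeInd, Bool.cond_eq_ite]

section Semantics

variable {V : Type*} [DecidableEq V]

omit [DecidableEq V] in
lemma Labels.forestInd_eq {e : ℕ → V} {B : Finset (Sym2 V)} {lab : ℕ → ℕ} (h : Labels e B lab)
    (a b c t : ℕ) : forestInd (e a) (e b) (e c) t (edgeGraph B) = typeInd a b c t lab := by
  have : connType (edgeGraph B) (e a) (e b) (e c) = labelType a b c lab := by
    rw [labelType_eq, connType]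
    simp only [h.2]
  rw [typeInd_eq, forestInd, this]
  simp [h.1]

omit [DecidableEq V] in
lemma labels_empty {e : ℕ → V} (he : e.Injective) : Labels e ∅ id := by
  simp [Labels, edgeGraph_empty, reachable_bot, he.eq_iff]

lemma edgeSum_spec {e : ℕ → V} (he : e.Injective) (a b c t : ℕ) (es : List (ℕ × ℕ))
    (hne : ∀ p ∈ es, p.1 ≠ p.2) (hes : (es.map fun p => s(p.1, p.2)).Nodup)
    {B : Finset (Sym2 V)} {lab : ℕ → ℕ} (h : Labels e B lab)
    (hB : ∀ p ∈ es, s(e p.1, e p.2) ∉ B) :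
    ∑ S ∈ (es.toFinset.image fun p => s(e p.1, e p.2)).powerset,
      forestInd (e a) (e b) (e c) t (edgeGraph (S ∪ B)) =
      edgeSum (typeInd a b c t) es lab := by
  induction es generalizing B lab with
  | nil => simp [edgeSum, h.forestInd_eq]
  | cons p es ih =>
    obtain ⟨i, j⟩ := p
    simp only [List.map_cons, List.nodup_cons] at hes
    simp only [List.mem_cons, forall_eq_or_imp] at hne hB
    have hni : s(e i, e j) ∉ es.toFinset.image fun p => s(e p.1, e p.2) := by
      intro hmem
      obtain ⟨p, hp, hpe⟩ := Finset.mem_image.1 hmem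
      refine hes.1 (List.mem_map.2 ⟨p, List.mem_toFinset.1 hp, ?_⟩)
      rw [← Sym2.map_mk, ← Sym2.map_mk] at hpe
      exact Sym2.map.injective he hpe
    rw [List.toFinset_cons, Finset.image_insert, Finset.sum_powerset_insert hni, edgeSum]
    congr 1
    · exact ih hne.2 hes.2 h hB.2
    · simp only [Finset.insert_union, ← Finset.union_insert]
      refine h.sum_insert hB.1 (he.ne hne.1) _ _ _ _ _ _ fun lab' h' => ?_
      refine ih hne.2 hes.2 h' fun p hp hp' => ?_
      rcases Finset.mem_insert.1 hp' with hp' | hp'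
      · exact hni (Finset.mem_image.2 ⟨p, List.mem_toFinset.2 hp, hp'⟩)
      · exact hB.2 p hp hp'

/-- The two ends of an edge meet a cell, with vertex set `U` and corners `T`, in at most one of
its corners. -/
def Apart (U T : Set V) (x y : V) : Prop :=
  x ≠ y ∧ (x ∈ U → x ∈ T) ∧ (y ∈ U → y ∈ T) ∧ ¬ (x ∈ U ∧ y ∈ U)

/-- The three corners of a cell. -/
def cornerSet (e : ℕ → V) (q : ℕ × ℕ × ℕ) : Set V := {e q.1, e q.2.1, e q.2.2}

lemma typeEdges_subset {a b c x y : V} {t : ℕ} (hab : a ≠ b) (hac : a ≠ c) (hbc : b ≠ c)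
    (h : s(x, y) ∈ typeEdges a b c t) :
    x ∈ ({a, b, c} : Set V) ∧ y ∈ ({a, b, c} : Set V) ∧ x ≠ y := by
  unfold typeEdges at h
  split at h <;> simp at h <;> grind

/-- The rest of the graph sees a cell only through its corners. A forest in the cell can therefore
be exchanged for the representative `typeEdges` of its type, and summing over the forests of one
type gives a factor. Cyclic choices in the cell contribute nothing to either side. -/
lemma sum_piece {Eq E' B : Finset (Sym2 V)} {U : Set V} {i j k a b c : V} (t : ℕ)
    (hi : i ∈ U) (hj : j ∈ U) (hk : k ∈ U) (hij : i ≠ j) (hik : i ≠ k) (hjk : j ≠ k)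
    (hE : ∀ x y, s(x, y) ∈ Eq → x ∈ U ∧ y ∈ U ∧ x ≠ y)
    (hE' : ∀ x y, s(x, y) ∈ E' → Apart U {i, j, k} x y)
    (hB : ∀ x y, s(x, y) ∈ B → Apart U {i, j, k} x y)
    (ha : a ∈ U → a ∈ ({i, j, k} : Set V)) (hb : b ∈ U → b ∈ ({i, j, k} : Set V))
    (hc : c ∈ U → c ∈ ({i, j, k} : Set V)) :
    ∑ S ∈ (Eq ∪ E').powerset, forestInd a b c t (edgeGraph (S ∪ B)) =
      ∑ τ ∈ Finset.range 5, (∑ S ∈ Eq.powerset, forestInd i j k τ (edgeGraph S)) *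
        ∑ S ∈ E'.powerset, forestInd a b c t (edgeGraph (S ∪ (typeEdges i j k τ ∪ B))) := by
  have hdisj : ∀ {A D : Finset (Sym2 V)}, (∀ x y, s(x, y) ∈ A → Apart U {i, j, k} x y) →
      (∀ x y, s(x, y) ∈ D → x ∈ U ∧ y ∈ U ∧ x ≠ y) → Disjoint A D := by
    intro A D hA hD
    rw [Finset.disjoint_left]
    intro z hz hz'
    induction z with | h x y
    exact (hA x y hz).2.2.2 ⟨(hD x y hz').1, (hD x y hz').2.1⟩
  have hTU : ∀ x ∈ ({i, j, k} : Set V), x ∈ U := by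
    rintro x (rfl | rfl | rfl) <;> assumption
  rw [sum_powerset_union (M := ℕ) (hdisj hE' hE).symm]
  simp_rw [Finset.sum_mul]
  rw [Finset.sum_comm (s := Finset.range 5)]
  refine Finset.sum_congr rfl fun S hS => ?_
  rw [Finset.mem_powerset] at hS
  by_cases hac : (edgeGraph S).IsAcyclic
  · rw [Finset.sum_eq_single (connType (edgeGraph S) i j k)]
    · rw [forestInd, if_pos ⟨hac, rfl⟩, one_mul]
      refine Finset.sum_congr rfl fun S' hS' => ?_
      rw [Finset.mem_powerset] at hS'
      have hspec := typeEdges_spec hij hik hjk (connType_lt (edgeGraph S) i j k)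
      set R := typeEdges i j k (connType (edgeGraph S) i j k) with hR
      have hA : ∀ x y, s(x, y) ∈ S' ∪ B → Apart U {i, j, k} x y := by
        intro x y h
        rcases Finset.mem_union.1 h with h | h
        · exact hE' x y (hS' h)
        · exact hB x y h
      have hSU : ∀ x y, s(x, y) ∈ S → x ∈ U ∧ y ∈ U ∧ x ≠ y := fun x y h => hE x y (hS h)
      have hRU : ∀ x y, s(x, y) ∈ R → x ∈ U ∧ y ∈ U ∧ x ≠ y := fun x y h =>
        have h' := typeEdges_subset hij hik hjk h
        ⟨hTU x h'.1, hTU y h'.2.1, h'.2.2⟩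
      -- `W` consists of everything except the non-corner points of the cell; it contains the ends
      -- of all other edges as well as `a`, `b`, `c`.
      obtain ⟨h1, h2⟩ := edgeGraph_exchange (W := {x | x ∈ U → x ∈ ({i, j, k} : Set V)})
        (fun x y h => ⟨(hA x y h).2.1, (hA x y h).2.2.1, (hA x y h).1⟩)
        (hdisj hA hSU) (hdisj hA hRU) (iff_of_true hac hspec.1)
        (fun x hx y hy => edgeGraph_reachable_congr (fun x y h => ⟨(hSU x y h).1, (hSU x y h).2.1⟩)
          (fun x y h => ⟨(hRU x y h).1, (hRU x y h).2.1⟩)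
          (fun x hx y hy => reachable_iff_of_mem hspec.2.symm hx hy) hx hy)
      rw [show S ∪ S' ∪ B = S' ∪ B ∪ S by rw [Finset.union_assoc, Finset.union_comm],
        show S' ∪ (R ∪ B) = S' ∪ B ∪ R by rw [Finset.union_comm R, Finset.union_assoc]]
      exact forestInd_congr h1 (h2 a ha b hb) (h2 a ha c hc) (h2 b hb c hc)
    · intro τ _ hτ
      rw [forestInd, if_neg fun h => hτ h.2.symm, zero_mul]
    · exact fun h => absurd (Finset.mem_range.2 (connType_lt _ _ _ _)) h
  · rw [Finset.sum_eq_zero, Finset.sum_eq_zero]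
    · intro τ _
      rw [forestInd, if_neg fun h => hac h.1, zero_mul]
    · intro S' _
      refine if_neg fun h => hac (h.1.anti (fromEdgeSet_mono (Finset.coe_subset.2 ?_)))
      exact Finset.subset_union_left.trans Finset.subset_union_left

/-- Counting the forests in a union of triangular cells that meet only in corners. -/
theorem glueSum_spec {e : ℕ → V} (he : e.Injective) (a b c t : ℕ) (w : ℕ → ℕ)
    (E : ℕ × ℕ × ℕ → Finset (Sym2 V)) (U : ℕ × ℕ × ℕ → Set V) (cs : List (ℕ × ℕ × ℕ))
    (hE : ∀ q ∈ cs, ∀ x y, s(x, y) ∈ E q → x ∈ U q ∧ y ∈ U q ∧ x ≠ y)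
    (hU : ∀ q ∈ cs, cornerSet e q ⊆ U q)
    (hq : ∀ q ∈ cs, q.1 ≠ q.2.1 ∧ q.1 ≠ q.2.2 ∧ q.2.1 ≠ q.2.2)
    (hw : ∀ q ∈ cs, ∀ τ < 5,
      ∑ S ∈ (E q).powerset, forestInd (e q.1) (e q.2.1) (e q.2.2) τ (edgeGraph S) = w τ)
    (habc : ∀ q ∈ cs, ∀ i ∈ [a, b, c], e i ∈ U q → e i ∈ cornerSet e q)
    (hcs : cs.Pairwise fun q r => (∀ x ∈ U r, ∀ y ∈ U r, x ≠ y → Apart (U q) (cornerSet e q) x y) ∧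
      (∀ x ∈ U q, ∀ y ∈ U q, x ≠ y → Apart (U r) (cornerSet e r) x y))
    {B : Finset (Sym2 V)} {lab : ℕ → ℕ} (h : Labels e B lab)
    (hB : ∀ x y, s(x, y) ∈ B → ∀ q ∈ cs, Apart (U q) (cornerSet e q) x y) :
    ∑ S ∈ (cs.toFinset.biUnion E).powerset,
      forestInd (e a) (e b) (e c) t (edgeGraph (S ∪ B)) =
      glueSum (w 0) (w 1) (w 2) (w 3) (w 4) (typeInd a b c t) cs lab := by
  -- `B` collects the representative edges chosen for the cells already treated, and `lab` records
  -- its components on the points `e i`.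
  induction cs generalizing B lab with
  | nil => simp [glueSum, h.forestInd_eq]
  | cons q cs ih =>
    simp only [List.mem_cons, forall_eq_or_imp] at hE hU hq hw hB
    have habc := List.forall_mem_cons.1 habc
    rw [List.pairwise_cons] at hcs
    have hni : ∀ {i j}, i ∈ U q → j ∈ U q → s(i, j) ∉ B := fun hi hj h =>
      (hB _ _ h).1.2.2.2 ⟨hi, hj⟩
    obtain ⟨i, j, k⟩ := q
    have hi : e i ∈ U (i, j, k) := hU.1 (by simp [cornerSet])
    have hj : e j ∈ U (i, j, k) := hU.1 (by simp [cornerSet])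
    have hk : e k ∈ U (i, j, k) := hU.1 (by simp [cornerSet])
    have hij := he.ne hq.1.1
    have hik := he.ne hq.1.2.1
    have hjk := he.ne hq.1.2.2
    have hB2 : ∀ x y, s(x, y) ∈ B → ∀ q ∈ cs, Apart (U q) (cornerSet e q) x y :=
      fun x y h => (hB x y h).2
    have hins : ∀ {B : Finset (Sym2 V)} {x y : V},
        (∀ x y, s(x, y) ∈ B → ∀ q ∈ cs, Apart (U q) (cornerSet e q) x y) →
        x ∈ U (i, j, k) → y ∈ U (i, j, k) → x ≠ y →
        ∀ x' y', s(x', y') ∈ insert s(x, y) B → ∀ q ∈ cs, Apart (U q) (cornerSet e q) x' y' := by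
      intro B x y hB hx hy hxy x' y' h' q hq
      rcases Finset.mem_insert.1 h' with h' | h'
      · rw [Sym2.eq_iff] at h'
        rcases h' with ⟨rfl, rfl⟩ | ⟨rfl, rfl⟩
        · exact (hcs.1 q hq).2 _ hx _ hy hxy
        · exact (hcs.1 q hq).2 _ hy _ hx hxy.symm
      · exact hB x' y' h' q hq
    have ih' := fun {B lab} => @ih hE.2 hU.2 hq.2 hw.2 habc.2 hcs.2 B lab
    rw [List.toFinset_cons, Finset.biUnion_insert,
      sum_piece t hi hj hk hij hik hjk hE.1 ?_ (fun x y h => (hB x y h).1)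
        (habc.1 a (by simp)) (habc.1 b (by simp)) (habc.1 c (by simp))]
    · simp only [Finset.sum_range_succ, Finset.sum_range_zero, zero_add, glueSum]
      rw [hw.1 0 (by norm_num), hw.1 1 (by norm_num), hw.1 2 (by norm_num), hw.1 3 (by norm_num),
        hw.1 4 (by norm_num)]
      congr 1; congr 1; congr 1; congr 1
      · congr 1
        simpa [typeEdges] using ih' h hB2
      · congr 1
        refine h.sum_insert (hni hj hk) hjk _ _ _ _ _ _ fun lab' h' => ?_
        exact ih' h' (hins hB2 hj hk hjk)
      · congr 1
        refine h.sum_insert (hni hi hk) hik _ _ _ _ _ _ fun lab' h' => ?_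
        exact ih' h' (hins hB2 hi hk hik)
      · congr 1
        refine h.sum_insert (hni hi hj) hij _ _ _ _ _ _ fun lab' h' => ?_
        exact ih' h' (hins hB2 hi hj hij)
      · congr 1
        -- The edge i j is inserted before i k, matching the nested `joinThen` in the last term of
        -- `glueSum`.
        have hT : typeEdges (e i) (e j) (e k) 4 ∪ B = insert s(e i, e k) (insert s(e i, e j) B) := by
          rw [← Finset.singleton_union, ← Finset.singleton_union, ← Finset.union_assoc]; rfl
        rw [hT, joinThen_eq]
        split_ifs with hl
        · refine Finset.sum_eq_zero fun S _ => if_neg fun hS => ?_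
          have := hS.1.anti (G := edgeGraph (insert s(e i, e j) B))
            (fromEdgeSet_mono (Finset.coe_subset.2
              ((Finset.subset_insert _ _).trans Finset.subset_union_right)))
          exact ((edgeGraph_insert_isAcyclic (hni hi hj) hij).1 this).2 ((h.2 i j).2 hl)
        · refine (h.insert_edge (hni hi hj) hij hl).sum_insert ?_ hik _ _ _ _ _ _ fun lab' h' => ?_
          · rw [Finset.mem_insert, not_or]
            exact ⟨by simp [hij, hjk.symm], hni hi hk⟩
          · exact ih' h' (hins (hins hB2 hi hj hij) hi hk hik)
    · intro x y hxy
      obtain ⟨r, hr, hxy⟩ := Finset.mem_biUnion.1 hxy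
      have hr := List.mem_toFinset.1 hr
      obtain ⟨hx, hy, hne⟩ := hE.2 r hr x y hxy
      exact (hcs.1 r hr).1 x hx y hy hne

end Semantics

/-! ### How translated triangles meet -/

/-- The lattice points of the upward-pointing triangle of side `s` at the origin. -/
def triangle (s : ℕ) : Set (ℕ × ℕ) := {u | u.1 + u.2 ≤ s}

/-- Two distinct translates of a triangle by multiples of its side share at most a corner. -/
lemma exists_corner_of_ne {c d : ℕ × ℕ} (h : c ≠ d) (s : ℕ) :
    ∃ t ∈ ({(0, 0), (1, 0), (0, 1)} : Set (ℕ × ℕ)), ∀ u ∈ triangle s, ∀ v ∈ triangle s,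
      s • c + u = s • d + v → u = s • t := by
  obtain ⟨c₁, c₂⟩ := c
  obtain ⟨d₁, d₂⟩ := d
  have tri : ∀ a b : ℕ, (∃ k, a = b + 2 + k) ∨ a = b + 1 ∨ a = b ∨ b = a + 1 ∨
      ∃ k, b = a + 2 + k := by
    intro a b
    rcases lt_trichotomy a b with h | h | h
    · obtain ⟨k, rfl⟩ := Nat.exists_eq_add_of_lt h
      rcases k with _ | k
      · simp
      · exact Or.inr (Or.inr (Or.inr (Or.inr ⟨k, by ring⟩)))
    · simp [h]
    · obtain ⟨k, rfl⟩ := Nat.exists_eq_add_of_lt h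
      rcases k with _ | k
      · simp
      · exact Or.inl ⟨k, by ring⟩
  -- If d is one step further in a coordinate, a common point has that coordinate of u at least s,
  -- which forces u to be the corner in that direction. In the remaining cases any common point is
  -- the corner at the origin of the copy at c.
  refine ⟨if d₁ = c₁ + 1 then (1, 0) else if d₂ = c₂ + 1 then (0, 1) else (0, 0), ?_, ?_⟩
  · split_ifs <;> simp
  rintro ⟨u₁, u₂⟩ hu ⟨v₁, v₂⟩ hv huv
  simp only [triangle, Set.mem_ofPred_eq, Prod.smul_mk, smul_eq_mul, Prod.mk_add_mk,
    Prod.mk.injEq] at hu hv huv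
  rcases tri c₁ d₁ with ⟨k, rfl⟩ | rfl | rfl | rfl | ⟨k, rfl⟩ <;>
  rcases tri c₂ d₂ with ⟨l, rfl⟩ | rfl | rfl | rfl | ⟨l, rfl⟩ <;>
  (try simp only [mul_add, mul_one, mul_two] at huv) <;>
  first
  | (exact absurd rfl h)
  | (split_ifs <;> simp <;> omega)

/-- With p - c = (k, l), membership in the triangle gives s * (k + l) ≤ s, so k + l ≤ 1. -/
lemma eq_corner_of_smul_eq {s : ℕ} (hs : 0 < s) {p c u : ℕ × ℕ} (hu : u ∈ triangle s)
    (h : s • p = s • c + u) : p = c ∨ p = c + (1, 0) ∨ p = c + (0, 1) := by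
  obtain ⟨p₁, p₂⟩ := p
  obtain ⟨c₁, c₂⟩ := c
  obtain ⟨u₁, u₂⟩ := u
  simp only [triangle, Set.mem_ofPred_eq, Prod.smul_mk, smul_eq_mul, Prod.mk_add_mk,
    Prod.mk.injEq] at hu h
  have h1 : c₁ ≤ p₁ := Nat.le_of_mul_le_mul_left (by omega) hs
  have h2 : c₂ ≤ p₂ := Nat.le_of_mul_le_mul_left (by omega) hs
  obtain ⟨k, rfl⟩ := Nat.exists_eq_add_of_le h1
  obtain ⟨l, rfl⟩ := Nat.exists_eq_add_of_le h2
  have h3 : k + l ≤ 1 := Nat.le_of_mul_le_mul_left (by simp only [mul_add] at *; omega) hs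
  simp
  omega

/-- The edges of the gasket as a finite set. -/
def gasketEdgeSet : ℕ → Finset (Sym2 (ℕ × ℕ))
  | 0 => {s((0, 0), (1, 0)), s((0, 0), (0, 1)), s((1, 0), (0, 1))}
  | n + 1 => (gasketCells 3).biUnion fun c =>
      (gasketEdgeSet n).image (Sym2.map fun p => 3 ^ n • c + p)

lemma gasketEdgeSet_spec {n : ℕ} {x y : ℕ × ℕ} (h : s(x, y) ∈ gasketEdgeSet n) :
    x ∈ triangle (3 ^ n) ∧ y ∈ triangle (3 ^ n) ∧ x ≠ y := by
  induction n generalizing x y with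
  | zero =>
    simp [gasketEdgeSet] at h
    rcases h with (⟨rfl, rfl⟩ | ⟨rfl, rfl⟩) | (⟨rfl, rfl⟩ | ⟨rfl, rfl⟩) | ⟨rfl, rfl⟩ | ⟨rfl, rfl⟩ <;>
      simp [triangle]
  | succ n ih =>
    obtain ⟨c, hc, h⟩ := Finset.mem_biUnion.1 h
    obtain ⟨z, hz, h⟩ := Finset.mem_image.1 h
    have hc : c.1 + c.2 ≤ 2 := by
      simp [gasketCells] at hc; omega
    have hmul : 3 ^ n * c.1 + 3 ^ n * c.2 ≤ 3 ^ n * 2 := by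
      rw [← mul_add]; exact Nat.mul_le_mul_left _ hc
    have key : ∀ u ∈ triangle (3 ^ n), 3 ^ n • c + u ∈ triangle (3 ^ (n + 1)) := by
      intro u hu
      simp only [triangle, Set.mem_ofPred_eq, Prod.fst_add, Prod.snd_add, Prod.smul_fst,
        Prod.smul_snd, smul_eq_mul, pow_succ] at hu ⊢
      omega
    induction z with | h u v
    obtain ⟨hu, hv, huv⟩ := ih hz
    rw [Sym2.map_mk, Sym2.eq_iff] at h
    rcases h with ⟨rfl, rfl⟩ | ⟨rfl, rfl⟩
    · exact ⟨key u hu, key v hv, fun h => huv (add_left_cancel h)⟩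
    · exact ⟨key v hv, key u hu, fun h => huv (add_left_cancel h).symm⟩

lemma gasketEdgeSet_not_isDiag {n : ℕ} {z : Sym2 (ℕ × ℕ)} (h : z ∈ gasketEdgeSet n) :
    ¬ z.IsDiag := by
  induction z with | h x y
  rw [Sym2.mk_isDiag_iff]
  exact (gasketEdgeSet_spec h).2.2

/-! ### The recursion for the counts by type -/

/-- The number of spanning forests of type `t` with respect to the three outer corners. -/
noncomputable def typeCount (n t : ℕ) : ℕ :=
  ∑ S ∈ (gasketEdgeSet n).powerset, forestInd (0, 0) (3 ^ n, 0) (0, 3 ^ n) t (edgeGraph S)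

/-- A numbering of lattice points. -/
def latticePoint (i : ℕ) : ℕ × ℕ := (i % 4, i / 4)

lemma latticePoint_injective : Function.Injective latticePoint := by
  intro i j h
  simp only [latticePoint, Prod.mk.injEq] at h
  omega

/-- The corners of the six cells, in the numbering `latticePoint`. -/
def cellList : List (ℕ × ℕ × ℕ) :=
  [(1, 2, 5), (4, 5, 8), (5, 6, 9), (0, 1, 4), (2, 3, 6), (8, 9, 12)]

/-- The points of the lattice of mesh `3 ^ n`. -/
def meshPoint (n i : ℕ) : ℕ × ℕ := 3 ^ n • latticePoint i

lemma smul_pair_injective {s : ℕ} (hs : 0 < s) :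
    Function.Injective fun p : ℕ × ℕ => s • p := by
  rintro ⟨a, b⟩ ⟨c, d⟩ h
  simpa [hs.ne'] using h

lemma meshPoint_injective (n : ℕ) : Function.Injective (meshPoint n) := fun i j h =>
  latticePoint_injective (smul_pair_injective (pow_pos (by norm_num) n) h)

lemma sum_forestInd_translate (E : Finset (Sym2 (ℕ × ℕ))) (hE : ∀ z ∈ E, ¬ z.IsDiag)
    (v a b c : ℕ × ℕ) (t : ℕ) :
    ∑ S ∈ (E.image (Sym2.map fun p => v + p)).powerset,
      forestInd (v + a) (v + b) (v + c) t (edgeGraph S) =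
    ∑ S ∈ E.powerset, forestInd a b c t (edgeGraph S) := by
  have hinj : Function.Injective fun p : ℕ × ℕ => v + p := add_right_injective v
  rw [Finset.powerset_image, Finset.sum_image
    ((Finset.image_injective (Sym2.map.injective hinj)).injOn)]
  refine Finset.sum_congr rfl fun S hS => ?_
  obtain ⟨h1, h2⟩ := edgeGraph_image _ hinj S fun z hz => hE z (Finset.mem_powerset.1 hS hz)
  exact forestInd_congr h1 (h2 a b) (h2 a c) (h2 b c)

/-- `glueSum_spec` applies because the six copies meet only in corners and each is a translate with
the same counts by type. The indices 0, 3, 12 number the outer corners, and `id` is the labelling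
without edges. The order of `cellList` plays no role in the argument. -/
theorem typeCount_succ (n t : ℕ) : typeCount (n + 1) t =
    glueSum (typeCount n 0) (typeCount n 1) (typeCount n 2) (typeCount n 3) (typeCount n 4)
      (typeInd 0 3 12 t) cellList id := by
  have hs : 0 < 3 ^ n := pow_pos (by norm_num) n
  have hcells : ∀ q ∈ cellList, latticePoint q.2.1 = latticePoint q.1 + (1, 0) ∧
      latticePoint q.2.2 = latticePoint q.1 + (0, 1) := by decide
  have hcorner : ∀ q ∈ cellList, meshPoint n q.2.1 = meshPoint n q.1 + (3 ^ n, 0) ∧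
      meshPoint n q.2.2 = meshPoint n q.1 + (0, 3 ^ n) := by
    intro q hq
    simp [meshPoint, hcells q hq]
  set U : ℕ × ℕ × ℕ → Set (ℕ × ℕ) := fun q => (meshPoint n q.1 + ·) '' triangle (3 ^ n) with hU
  have hUcorner : ∀ q ∈ cellList, ∀ t ∈ ({(0, 0), (1, 0), (0, 1)} : Set (ℕ × ℕ)),
      meshPoint n q.1 + 3 ^ n • t ∈ cornerSet (meshPoint n) q := by
    rintro q hq t (rfl | rfl | rfl)
    · simp [cornerSet]
    · simp [cornerSet, hcorner q hq]
    · simp [cornerSet, hcorner q hq]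
  have hapart : ∀ q ∈ cellList, ∀ r ∈ cellList, q.1 ≠ r.1 → ∀ x ∈ U r, ∀ y ∈ U r, x ≠ y →
      Apart (U q) (cornerSet (meshPoint n) q) x y := by
    intro q hq r hr hqr x hx y hy hxy
    obtain ⟨t, ht, hmeet⟩ := exists_corner_of_ne
      (latticePoint_injective.ne hqr) (3 ^ n)
    have key : ∀ z ∈ U r, z ∈ U q → z = meshPoint n q.1 + 3 ^ n • t := by
      rintro z ⟨v, hv, rfl⟩ ⟨u, hu, huv⟩
      rw [← huv, ← hmeet u hu v hv huv]
    refine ⟨hxy, fun h => ?_, fun h => ?_, fun h => hxy ?_⟩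
    · rw [key x hx h]; exact hUcorner q hq t ht
    · rw [key y hy h]; exact hUcorner q hq t ht
    · rw [key x hx h.1, key y hy h.2]
  have hverts : cellList.toFinset.image (fun q => latticePoint q.1) = gasketCells 3 := by decide
  have hE : gasketEdgeSet (n + 1) = cellList.toFinset.biUnion fun q =>
      (gasketEdgeSet n).image (Sym2.map fun p => meshPoint n q.1 + p) := by
    rw [gasketEdgeSet, ← hverts, Finset.image_biUnion]; rfl
  have h0 : meshPoint n 0 = (0, 0) := by simp [meshPoint, latticePoint]
  have h3 : meshPoint n 3 = (3 ^ (n + 1), 0) := by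
    rw [meshPoint, show latticePoint 3 = (3, 0) by decide]; simp [pow_succ]
  have h12 : meshPoint n 12 = (0, 3 ^ (n + 1)) := by
    rw [meshPoint, show latticePoint 12 = (0, 3) by decide]; simp [pow_succ]
  have := glueSum_spec (meshPoint_injective n) 0 3 12 t (typeCount n)
    (fun q => (gasketEdgeSet n).image (Sym2.map fun p => meshPoint n q.1 + p)) U cellList
    ?_ ?_ (by decide) ?_ ?_ ?_ (labels_empty (meshPoint_injective n)) (by simp)
  · rw [h0, h3, h12, ← hE] at this
    simpa [typeCount] using this
  · intro q hq x y h
    obtain ⟨z, hz, h⟩ := Finset.mem_image.1 h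
    induction z with | h u v
    obtain ⟨hu, hv, huv⟩ := gasketEdgeSet_spec hz
    rw [Sym2.map_mk, Sym2.eq_iff] at h
    rcases h with ⟨rfl, rfl⟩ | ⟨rfl, rfl⟩
    · exact ⟨⟨u, hu, rfl⟩, ⟨v, hv, rfl⟩, fun h => huv (add_left_cancel h)⟩
    · exact ⟨⟨v, hv, rfl⟩, ⟨u, hu, rfl⟩, fun h => huv (add_left_cancel h).symm⟩
  · rintro q hq x (rfl | rfl | rfl)
    · exact ⟨(0, 0), by simp [triangle], by simp⟩
    · exact ⟨(3 ^ n, 0), by simp [triangle], (hcorner q hq).1.symm⟩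
    · exact ⟨(0, 3 ^ n), by simp [triangle], (hcorner q hq).2.symm⟩
  · intro q hq τ _
    rw [(hcorner q hq).1, (hcorner q hq).2]
    nth_rw 2 [← add_zero (meshPoint n q.1)]
    exact sum_forestInd_translate _ (fun z hz => gasketEdgeSet_not_isDiag hz) _ _ _ _ _
  -- No mesh point, outer corner or not, lies in a cell other than as one of its corners.
  · rintro q hq i - ⟨u, hu, h⟩
    have hi := eq_corner_of_smul_eq hs hu h.symm
    rw [← (hcells q hq).1, ← (hcells q hq).2] at hi
    unfold cornerSet meshPoint
    rcases hi with h | h | h <;> simp [h]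
  · have hne : cellList.Pairwise fun q r => q.1 ≠ r.1 := by decide
    exact hne.imp_of_mem fun {q r} hq hr h => ⟨hapart q hq r hr h, hapart r hr q hq h.symm⟩

theorem typeCount_zero (t : ℕ) :
    typeCount 0 t = edgeSum (typeInd 0 1 4 t) [(0, 1), (0, 4), (1, 4)] id := by
  have := edgeSum_spec (meshPoint_injective 0) 0 1 4 t [(0, 1), (0, 4), (1, 4)]
    (by decide) (by decide) (labels_empty (meshPoint_injective 0)) (by simp)
  rw [← this, typeCount]
  have h0 : meshPoint 0 0 = (0, 0) := by simp [meshPoint, latticePoint]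
  have h4 : meshPoint 0 4 = (0, 1) := by
    rw [meshPoint, show latticePoint 4 = (0, 1) by decide]; simp
  have h1 : meshPoint 0 1 = (1, 0) := by
    rw [meshPoint, show latticePoint 1 = (1, 0) by decide]; simp
  simp [gasketEdgeSet, h0, h1, h4]

/-! ### Bounds for gluing sums, and linearity in the final weight -/

section GlueSum

variable {w₀ w₁ w₂ w₃ w₄ : ℕ}

lemma joinThen_le {i j : ℕ} {lab : ℕ → ℕ} {f : (ℕ → ℕ) → ℕ} {M : ℕ} (h : ∀ l, f l ≤ M) :
    joinThen i j lab f ≤ M := by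
  rw [joinThen_eq]
  split_ifs
  · exact Nat.zero_le _
  · exact h _

lemma joinThen_add (i j : ℕ) (lab : ℕ → ℕ) (f g : (ℕ → ℕ) → ℕ) :
    joinThen i j lab (fun l => f l + g l) = joinThen i j lab f + joinThen i j lab g := by
  simp only [joinThen_eq]
  split_ifs <;> rfl

lemma joinThen_mul (i j : ℕ) (lab : ℕ → ℕ) (M : ℕ) (f : (ℕ → ℕ) → ℕ) :
    joinThen i j lab (fun l => M * f l) = M * joinThen i j lab f := by
  simp only [joinThen_eq]
  split_ifs <;> rfl

/-- Ignoring the condition that no cycle is closed can only increase the sum. -/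
lemma glueSum_le {φ : (ℕ → ℕ) → ℕ} {M : ℕ} (h : ∀ l, φ l ≤ M) (cs : List (ℕ × ℕ × ℕ))
    (lab : ℕ → ℕ) :
    glueSum w₀ w₁ w₂ w₃ w₄ φ cs lab ≤ (w₀ + w₁ + w₂ + w₃ + w₄) ^ cs.length * M := by
  induction cs generalizing lab with
  | nil => simpa [glueSum] using h lab
  | cons q cs ih =>
    rw [List.length_cons, pow_succ', mul_assoc]
    simp only [glueSum, add_mul]
    gcongr
    · exact ih lab
    · exact joinThen_le ih
    · exact joinThen_le ih
    · exact joinThen_le ih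
    · exact joinThen_le fun l => joinThen_le ih

/-- Only the term in which every cell has separated corners is kept; it never changes the labelling.
-/
lemma le_glueSum (φ : (ℕ → ℕ) → ℕ) (cs : List (ℕ × ℕ × ℕ)) (lab : ℕ → ℕ) :
    w₀ ^ cs.length * φ lab ≤ glueSum w₀ w₁ w₂ w₃ w₄ φ cs lab := by
  induction cs with
  | nil => simp [glueSum]
  | cons q cs ih =>
    rw [List.length_cons, pow_succ', mul_assoc]
    simp only [glueSum]
    calc w₀ * (w₀ ^ cs.length * φ lab) ≤ w₀ * glueSum w₀ w₁ w₂ w₃ w₄ φ cs lab :=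
          Nat.mul_le_mul_left _ ih
      _ ≤ _ := by omega

lemma glueSum_add (φ ψ : (ℕ → ℕ) → ℕ) (cs : List (ℕ × ℕ × ℕ)) (lab : ℕ → ℕ) :
    glueSum w₀ w₁ w₂ w₃ w₄ (fun l => φ l + ψ l) cs lab =
      glueSum w₀ w₁ w₂ w₃ w₄ φ cs lab + glueSum w₀ w₁ w₂ w₃ w₄ ψ cs lab := by
  induction cs generalizing lab with
  | nil => rfl
  | cons q cs ih =>
    have ih' := funext ih
    simp only [glueSum, ih', joinThen_add]
    ring

lemma glueSum_mul (M : ℕ) (φ : (ℕ → ℕ) → ℕ) (cs : List (ℕ × ℕ × ℕ)) (lab : ℕ → ℕ) :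
    glueSum w₀ w₁ w₂ w₃ w₄ (fun l => M * φ l) cs lab =
      M * glueSum w₀ w₁ w₂ w₃ w₄ φ cs lab := by
  induction cs generalizing lab with
  | nil => rfl
  | cons q cs ih =>
    have ih' := funext ih
    simp only [glueSum, ih', joinThen_mul]
    ring

end GlueSum

/-! ### Total counts and exact values for small stages -/

/-- The number of spanning forests, as the sum over the five types. -/
noncomputable def forestCount (n : ℕ) : ℕ := ∑ t ∈ Finset.range 5, typeCount n t

lemma forestCount_eq (n : ℕ) : forestCount n =
    typeCount n 0 + typeCount n 1 + typeCount n 2 + typeCount n 3 + typeCount n 4 := by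
  simp [forestCount, Finset.sum_range_succ]

lemma sum_mul_typeInd (f : ℕ → ℕ) (a b c : ℕ) (lab : ℕ → ℕ) :
    f 0 * typeInd a b c 0 lab + f 1 * typeInd a b c 1 lab + f 2 * typeInd a b c 2 lab +
      f 3 * typeInd a b c 3 lab + f 4 * typeInd a b c 4 lab = f (labelType a b c lab) := by
  have : labelType a b c lab < 5 := by rw [labelType_eq]; split_ifs <;> norm_num
  simp only [typeInd_eq]
  interval_cases labelType a b c lab <;> simp

/-- By linearity in the final weight, any weighted total of the five counts is a single gluing sum.
It is used with constant weight 1 and with powers of a base. -/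
lemma sum_mul_typeCount_succ (f : ℕ → ℕ) (n : ℕ) :
    f 0 * typeCount (n + 1) 0 + f 1 * typeCount (n + 1) 1 + f 2 * typeCount (n + 1) 2 +
      f 3 * typeCount (n + 1) 3 + f 4 * typeCount (n + 1) 4 =
    glueSum (typeCount n 0) (typeCount n 1) (typeCount n 2) (typeCount n 3) (typeCount n 4)
      (fun lab => f (labelType 0 3 12 lab)) cellList id := by
  simp only [typeCount_succ, ← glueSum_mul, ← glueSum_add, sum_mul_typeInd]

lemma forestCount_succ (n : ℕ) : forestCount (n + 1) =
    glueSum (typeCount n 0) (typeCount n 1) (typeCount n 2) (typeCount n 3) (typeCount n 4)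
      (fun _ => 1) cellList id := by
  rw [← sum_mul_typeCount_succ (fun _ => 1), forestCount_eq]
  simp only [one_mul]

lemma forestCount_succ_le (n : ℕ) : forestCount (n + 1) ≤ forestCount n ^ 6 := by
  rw [forestCount_succ, forestCount_eq]
  refine (glueSum_le (M := 1) (fun _ => le_rfl) cellList id).trans_eq ?_
  simp [cellList]

lemma le_typeCount_succ (n : ℕ) : typeCount n 0 ^ 6 ≤ typeCount (n + 1) 0 := by
  rw [typeCount_succ]
  refine le_trans ?_ (le_glueSum _ _ _)
  simp [cellList, typeInd_eq, labelType_eq]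

/-- One evaluation yields all five counts: type t is weighted by b ^ t, and the counts are read off
as base-b digits. They are smaller than b because their sum is at most the sixth power of the
previous total. -/
lemma typeCount_succ_eq {n : ℕ} {w₀ w₁ w₂ w₃ w₄ : ℕ} (h₀ : typeCount n 0 = w₀)
    (h₁ : typeCount n 1 = w₁) (h₂ : typeCount n 2 = w₂) (h₃ : typeCount n 3 = w₃)
    (h₄ : typeCount n 4 = w₄) (b : ℕ) {v₀ v₁ v₂ v₃ v₄ : ℕ}
    (hb : (w₀ + w₁ + w₂ + w₃ + w₄) ^ 6 < b) (hb₁ : 1 < b)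
    (hv : v₀ < b ∧ v₁ < b ∧ v₂ < b ∧ v₃ < b ∧ v₄ < b)
    (h : glueSum w₀ w₁ w₂ w₃ w₄ (fun lab => b ^ labelType 0 3 12 lab) cellList id =
      b ^ 0 * v₀ + b ^ 1 * v₁ + b ^ 2 * v₂ + b ^ 3 * v₃ + b ^ 4 * v₄) :
    typeCount (n + 1) 0 = v₀ ∧ typeCount (n + 1) 1 = v₁ ∧ typeCount (n + 1) 2 = v₂ ∧
      typeCount (n + 1) 3 = v₃ ∧ typeCount (n + 1) 4 = v₄ := by
  subst h₀ h₁ h₂ h₃ h₄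
  have hlt := (forestCount_succ_le n).trans_lt (forestCount_eq n ▸ hb)
  rw [forestCount_eq] at hlt
  rw [← sum_mul_typeCount_succ (fun t => b ^ t)] at h
  have := Nat.ofDigits_inj_of_len_eq hb₁
    (L1 := [typeCount (n + 1) 0, typeCount (n + 1) 1, typeCount (n + 1) 2, typeCount (n + 1) 3,
      typeCount (n + 1) 4]) (L2 := [v₀, v₁, v₂, v₃, v₄]) rfl
    (by simp only [List.mem_cons, List.not_mem_nil, or_false]; omega)
    (by simp only [List.mem_cons, List.not_mem_nil, or_false]; omega)
    (by simp only [Nat.ofDigits_cons, Nat.ofDigits_nil]; linarith)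
  simpa using this

lemma typeCount_zero_eq : typeCount 0 0 = 1 ∧
    typeCount 0 1 = 1 ∧
    typeCount 0 2 = 1 ∧
    typeCount 0 3 = 1 ∧
    typeCount 0 4 = 3 := by
  simp only [typeCount_zero]
  decide

lemma typeCount_one_eq : typeCount 1 0 = 29473 ∧
    typeCount 1 1 = 8020 ∧
    typeCount 1 2 = 8020 ∧
    typeCount 1 3 = 8020 ∧
    typeCount 1 4 = 8372 := by
  obtain ⟨h₀, h₁, h₂, h₃, h₄⟩ := typeCount_zero_eq
  exact typeCount_succ_eq h₀ h₁ h₂ h₃ h₄ (10 ^ 10) (by norm_num) (by norm_num) (by norm_num)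
    (by decide +kernel)

lemma typeCount_two_eq : typeCount 2 0 = 49198640408360507318938682849 ∧
    typeCount 2 1 = 1242664072161818527545741824 ∧
    typeCount 2 2 = 1242664072161818527545741824 ∧
    typeCount 2 3 = 1242664072161818527545741824 ∧
    typeCount 2 4 = 218891276004139532538695680 := by
  obtain ⟨h₀, h₁, h₂, h₃, h₄⟩ := typeCount_one_eq
  exact typeCount_succ_eq h₀ h₁ h₂ h₃ h₄ (10 ^ 40) (by norm_num) (by norm_num) (by norm_num)
    (by decide +kernel)

lemma typeCount_three_eq : typeCount 3 0 = 22529096896248555414917859653315680202729172127616762366440296854977797457874722866425889295825007216624786194355629950416454311036576741471726417966143905064957097931473729 ∧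
    typeCount 3 1 = 505785285484930105460850048326899274875784990901428730640960310752385336577246913332382583288407450391434053301559829792306404707096014965688818569355938649599398379520 ∧
    typeCount 3 2 = 505785285484930105460850048326899274875784990901428730640960310752385336577246913332382583288407450391434053301559829792306404707096014965688818569355938649599398379520 ∧
    typeCount 3 3 = 505785285484930105460850048326899274875784990901428730640960310752385336577246913332382583288407450391434053301559829792306404707096014965688818569355938649599398379520 ∧
    typeCount 3 4 = 489239324432156801623319209649088996654036475097443233708745893074869569582423616266902220306578509251770794801135233258639186415426422024129482239439162038898655232 := by
  obtain ⟨h₀, h₁, h₂, h₃, h₄⟩ := typeCount_two_eq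
  exact typeCount_succ_eq h₀ h₁ h₂ h₃ h₄ (10 ^ 200) (by norm_num) (by norm_num) (by norm_num)
    (by decide +kernel)

lemma le_typeCount_four : 1308091877389378 * 10 ^ 1019 ≤ typeCount 4 0 := by
  obtain ⟨h₀, h₁, h₂, h₃, h₄⟩ := typeCount_three_eq
  rw [typeCount_succ, h₀, h₁, h₂, h₃, h₄]
  decide +kernel

lemma forestCount_three_le : forestCount 3 ≤ 2253061474134434 * 10 ^ 157 := by
  obtain ⟨h₀, h₁, h₂, h₃, h₄⟩ := typeCount_three_eq
  rw [forestCount_eq, h₀, h₁, h₂, h₃, h₄]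
  norm_num

/-! ### The vertices of the gasket -/

lemma gasketVerts_subset_triangle (n : ℕ) : (gasketVerts 3 n : Set (ℕ × ℕ)) ⊆ triangle (3 ^ n) := by
  induction n with
  | zero => intro x hx; simp [gasketVerts] at hx; rcases hx with rfl | rfl | rfl <;> simp [triangle]
  | succ n ih =>
    intro x hx
    obtain ⟨c, hc, h⟩ := Finset.mem_biUnion.1 hx
    obtain ⟨u, hu, rfl⟩ := Finset.mem_image.1 h
    have hu := ih hu
    have hc : c.1 + c.2 ≤ 2 := by
      simp [gasketCells] at hc; omega
    have hmul : 3 ^ n * c.1 + 3 ^ n * c.2 ≤ 3 ^ n * 2 := by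
      rw [← mul_add]; exact Nat.mul_le_mul_left _ hc
    simp only [triangle, Set.mem_ofPred_eq, Prod.fst_add, Prod.snd_add, Prod.smul_fst,
      Prod.smul_snd, smul_eq_mul, pow_succ] at hu ⊢
    omega

/-- The outer corners of the gasket. -/
def outerCorners (n : ℕ) : Finset (ℕ × ℕ) :=
  ({(0, 0), (1, 0), (0, 1)} : Finset (ℕ × ℕ)).image fun p => 3 ^ n • p

lemma outerCorners_subset (n : ℕ) : outerCorners n ⊆ gasketVerts 3 n := by
  induction n with
  | zero => decide
  | succ n ih =>
    intro x hx
    obtain ⟨p, hp, rfl⟩ := Finset.mem_image.1 hx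
    refine Finset.mem_biUnion.2 ⟨2 • p, ?_, Finset.mem_image.2
      ⟨3 ^ n • p, ih (Finset.mem_image_of_mem _ hp), ?_⟩⟩
    · simp at hp
      rcases hp with rfl | rfl | rfl <;> decide
    · simp only [pow_succ, smul_smul, ← add_smul]
      congr 1

lemma card_outerCorners (n : ℕ) : (outerCorners n).card = 3 := by
  rw [outerCorners, Finset.card_image_of_injective _ (smul_pair_injective (pow_pos (by norm_num) n))]
  rfl

/-- Apart from their corners, the six copies are disjoint and avoid the mesh points, while their
corners form 10 mesh points in all: 6 * (v - 3) + 10 = 6 * v - 8. -/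
lemma card_gasketVerts_succ (n : ℕ) :
    (gasketVerts 3 (n + 1)).card + 8 = 6 * (gasketVerts 3 n).card := by
  have hs : 0 < 3 ^ n := pow_pos (by norm_num) n
  set I := gasketVerts 3 n \ outerCorners n with hI
  have hcard : I.card + 3 = (gasketVerts 3 n).card := by
    have := Finset.card_sdiff_add_card_eq_card (outerCorners_subset n)
    rwa [card_outerCorners] at this
  have hIt : ∀ u ∈ I, u ∈ triangle (3 ^ n) := fun u hu =>
    gasketVerts_subset_triangle n (Finset.mem_sdiff.1 hu).1
  have hIc : ∀ u ∈ I, ∀ p ∈ ({(0, 0), (1, 0), (0, 1)} : Set (ℕ × ℕ)), u ≠ 3 ^ n • p := by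
    rintro _ hu p hp rfl
    exact (Finset.mem_sdiff.1 hu).2 (Finset.mem_image_of_mem _ (by simpa using hp))
  set P : Finset (ℕ × ℕ) := (gasketCells 3).biUnion fun c =>
    ({(0, 0), (1, 0), (0, 1)} : Finset (ℕ × ℕ)).image fun p => c + p with hP
  have hPcard : P.card = 10 := by decide
  have hV : gasketVerts 3 (n + 1) =
      ((gasketCells 3).biUnion fun c => I.image fun p => 3 ^ n • c + p) ∪
        P.image (fun p => 3 ^ n • p) := by
    rw [gasketVerts, hP, Finset.biUnion_image, ← Finset.sup_eq_biUnion, ← Finset.sup_eq_biUnion,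
      ← Finset.sup_eq_biUnion, ← Finset.sup_eq_union, ← Finset.sup_sup]
    refine Finset.sup_congr rfl fun c _ => ?_
    rw [Pi.sup_apply, Finset.sup_eq_union, Finset.image_image,
      ← Finset.sdiff_union_of_subset (outerCorners_subset n), Finset.image_union, ← hI]
    congr 1
    rw [outerCorners, Finset.image_image]
    exact Finset.image_congr fun p _ => by simp [mul_add]
  have hdisj : Disjoint ((gasketCells 3).biUnion fun c => I.image fun p => 3 ^ n • c + p)
      (P.image (fun p => 3 ^ n • p)) := by
    rw [Finset.disjoint_left]
    intro x hx hx'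
    obtain ⟨c, -, hx⟩ := Finset.mem_biUnion.1 hx
    obtain ⟨u, hu, rfl⟩ := Finset.mem_image.1 hx
    obtain ⟨p, -, hp⟩ := Finset.mem_image.1 hx'
    rcases eq_corner_of_smul_eq hs (hIt u hu) hp with rfl | rfl | rfl
    · refine hIc u hu (0, 0) (by simp) ?_
      rw [show ((0 : ℕ), (0 : ℕ)) = 0 from rfl, smul_zero]
      simpa using hp.symm
    · rw [smul_add] at hp
      exact hIc u hu (1, 0) (by simp) (add_left_cancel hp).symm
    · rw [smul_add] at hp
      exact hIc u hu (0, 1) (by simp) (add_left_cancel hp).symm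
  rw [hV, Finset.card_union_of_disjoint hdisj, Finset.card_biUnion,
    Finset.card_image_of_injective _ (smul_pair_injective hs), hPcard]
  · simp only [Finset.card_image_of_injective I (add_right_injective _), Finset.sum_const,
      show (gasketCells 3).card = 6 by decide, smul_eq_mul]
    omega
  · intro c _ d _ hcd
    rw [Function.onFun_apply, Finset.disjoint_left]
    intro x hx hx'
    obtain ⟨u, hu, rfl⟩ := Finset.mem_image.1 hx
    obtain ⟨v, hv, h⟩ := Finset.mem_image.1 hx'
    obtain ⟨t, ht, hmeet⟩ := exists_corner_of_ne hcd (3 ^ n)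
    exact hIc u hu t ht (hmeet u (hIt u hu) v (hIt v hv) h.symm)

lemma card_gasketVerts (n : ℕ) : 5 * (gasketVerts 3 n).card = 7 * 6 ^ n + 8 := by
  induction n with
  | zero => rfl
  | succ n ih =>
    have := card_gasketVerts_succ n
    rw [pow_succ]
    omega

/-! ### Spanning forests of the gasket as edge sets -/

lemma gasketEdges_adj_iff {n : ℕ} {x y : ℕ × ℕ} :
    (gasketEdges 3 n).Adj x y ↔ s(x, y) ∈ gasketEdgeSet n := by
  induction n generalizing x y with
  | zero =>
    obtain ⟨a, b⟩ := x
    obtain ⟨c, d⟩ := y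
    simp [gasketEdges, gasketVerts, gasketEdgeSet]
    grind
  | succ n ih =>
    simp only [gasketEdges, gasketEdgeSet, iSup_adj, map_adj', Finset.mem_biUnion, Finset.mem_image,
      exists_prop]
    refine exists_congr fun c => and_congr_right fun _ => ?_
    constructor
    · rintro ⟨-, u, v, huv, rfl, rfl⟩
      exact ⟨s(u, v), ih.1 huv, Sym2.map_mk ..⟩
    · rintro ⟨z, hz, h⟩
      induction z with | h u v
      rw [Sym2.map_mk, Sym2.eq_iff] at h
      have huv := ih.2 hz
      rcases h with ⟨rfl, rfl⟩ | ⟨rfl, rfl⟩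
      · exact ⟨fun h => huv.ne (add_left_cancel h), u, v, huv, rfl, rfl⟩
      · exact ⟨fun h => huv.ne (add_left_cancel h).symm, v, u, huv.symm, rfl, rfl⟩

lemma mem_gasketVerts_of_edge {n : ℕ} {x y : ℕ × ℕ} (h : s(x, y) ∈ gasketEdgeSet n) :
    x ∈ gasketVerts 3 n ∧ y ∈ gasketVerts 3 n := by
  induction n generalizing x y with
  | zero =>
    simp [gasketEdgeSet] at h
    rcases h with (⟨rfl, rfl⟩ | ⟨rfl, rfl⟩) | (⟨rfl, rfl⟩ | ⟨rfl, rfl⟩) | ⟨rfl, rfl⟩ | ⟨rfl, rfl⟩ <;>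
      decide
  | succ n ih =>
    obtain ⟨c, hc, h⟩ := Finset.mem_biUnion.1 h
    obtain ⟨z, hz, h⟩ := Finset.mem_image.1 h
    have key : ∀ u ∈ gasketVerts 3 n, 3 ^ n • c + u ∈ gasketVerts 3 (n + 1) := fun u hu =>
      Finset.mem_biUnion.2 ⟨c, hc, Finset.mem_image_of_mem _ hu⟩
    induction z with | h u v
    rw [Sym2.map_mk, Sym2.eq_iff] at h
    rcases h with ⟨rfl, rfl⟩ | ⟨rfl, rfl⟩
    · exact ⟨key u (ih hz).1, key v (ih hz).2⟩
    · exact ⟨key v (ih hz).2, key u (ih hz).1⟩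

-- Edge sets are kept on the whole lattice so that copies can be glued without changing the vertex
-- type. Passing to the vertices of the gasket removes only isolated points, so it affects neither
-- acyclicity nor the edge set.
open Classical in
lemma numSpanningForests_gasket_eq_card (n : ℕ) : numSpanningForests (gasket 3 n) =
    {S ∈ (gasketEdgeSet n).powerset | (edgeGraph S).IsAcyclic}.card := by
  rw [numSpanningForests, ← Set.ncard_coe_finset]
  symm
  refine Set.ncard_congr (fun S _ => (edgeGraph S).comap (Subtype.val : gasketVerts 3 n → ℕ × ℕ))
    ?_ ?_ ?_
  · intro S hS
    obtain ⟨hS, hac⟩ := Finset.mem_filter.1 hS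
    refine ⟨fun x y h => ?_, hac.of_comap (Function.Embedding.subtype _)⟩
    exact gasketEdges_adj_iff.2 (Finset.mem_powerset.1 hS ((fromEdgeSet_adj _).1 h).1)
  · have key : ∀ S T : Finset (Sym2 (ℕ × ℕ)), S ⊆ gasketEdgeSet n →
        (edgeGraph S).comap (Subtype.val : gasketVerts 3 n → ℕ × ℕ) =
          (edgeGraph T).comap Subtype.val → S ⊆ T := by
      intro S T hS h z hz
      induction z with | h x y
      obtain ⟨hx, hy⟩ := mem_gasketVerts_of_edge (hS hz)
      have hxy : ((edgeGraph S).comap (Subtype.val : gasketVerts 3 n → ℕ × ℕ)).Adj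
          ⟨x, hx⟩ ⟨y, hy⟩ := (fromEdgeSet_adj _).2 ⟨hz, (gasketEdgeSet_spec (hS hz)).2.2⟩
      rw [h] at hxy
      exact ((fromEdgeSet_adj _).1 hxy).1
    intro S T hS hT h
    exact (key S T (Finset.mem_powerset.1 (Finset.mem_filter.1 hS).1) h).antisymm
      (key T S (Finset.mem_powerset.1 (Finset.mem_filter.1 hT).1) h.symm)
  · rintro F ⟨hF, hac⟩
    have hdiag : ∀ z ∈ F.edgeFinset, ¬ z.IsDiag := fun z hz =>
      F.not_isDiag_of_mem_edgeSet (mem_edgeFinset.1 hz)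
    have hFg : edgeGraph F.edgeFinset = F := by
      rw [edgeGraph, coe_edgeFinset, fromEdgeSet_edgeSet]
    have him := (edgeGraph_image Subtype.val Subtype.val_injective F.edgeFinset hdiag).1
    rw [hFg] at him
    refine ⟨F.edgeFinset.image (Sym2.map Subtype.val), ?_, ?_⟩
    · refine Finset.mem_coe.2 (Finset.mem_filter.2 ⟨Finset.mem_powerset.2 fun z hz => ?_, him.2 hac⟩)
      obtain ⟨e, he, rfl⟩ := Finset.mem_image.1 hz
      induction e with | h x y
      exact gasketEdges_adj_iff.1 (hF (mem_edgeFinset.1 he))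
    · ext x y
      rw [comap_adj, fromEdgeSet_adj, Finset.mem_coe, ← Sym2.map_mk,
        (Sym2.map.injective Subtype.val_injective).mem_finset_image, mem_edgeFinset, mem_edgeSet]
      exact ⟨fun h => h.1, fun h => ⟨h, fun h' => h.ne (Subtype.val_injective h')⟩⟩

lemma numSpanningForests_gasket (n : ℕ) :
    numSpanningForests (gasket 3 n) = forestCount n := by
  classical
  rw [numSpanningForests_gasket_eq_card, Finset.card_filter, forestCount]
  simp only [typeCount]
  rw [Finset.sum_comm]
  refine Finset.sum_congr rfl fun S _ => ?_
  rw [Finset.sum_eq_single (connType (edgeGraph S) (0, 0) (3 ^ n, 0) (0, 3 ^ n))]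
  · simp [forestInd]
  · exact fun t _ ht => if_neg fun h => ht h.2.symm
  · exact fun h => absurd (Finset.mem_range.2 (connType_lt _ _ _ _)) h

/-! ### The growth constant -/

lemma exp_one_bounds : 2.7182818284590452353 < Real.exp 1 ∧
    Real.exp 1 < 2.7182818284590452355 := by
  have := abs_le.1 Real.exp_one_near_20
  constructor <;> norm_num at * <;> linarith

set_option exponentiation.threshold 3000 in
lemma log_typeCount_four : 1.31235755933 * (7 / 5) * 6 ^ 4 ≤ Real.log (typeCount 4 0) := by
  have h : (1308091877389378 * 10 ^ 1019 : ℝ) ≤ typeCount 4 0 := by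
    exact_mod_cast le_typeCount_four
  refine le_trans ?_ (Real.log_le_log (by norm_num) h)
  rw [Real.le_log_iff_exp_le (by norm_num)]
  -- The exponent is 2381 plus this fraction; the integer part is handled by powers of e and the
  -- fraction by a Taylor bound.
  have hf := Real.exp_bound' (x := 4423614011 / 31250000000) (by norm_num) (by norm_num)
    (n := 10) (by norm_num)
  rw [show (1.31235755933 * (7 / 5) * 6 ^ 4 : ℝ) =
    (2381 : ℕ) * 1 + 4423614011 / 31250000000 by norm_num, Real.exp_add, Real.exp_nat_mul]
  refine (mul_le_mul (pow_le_pow_left₀ (Real.exp_pos 1).le exp_one_bounds.2.le 2381) hf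
    (Real.exp_pos _).le (by positivity)).trans ?_
  norm_num [Finset.sum_range_succ, Nat.factorial]

set_option exponentiation.threshold 1000 in
lemma log_forestCount_three : Real.log (forestCount 3) < 1.31235755934 * (7 / 5) * 6 ^ 3 := by
  have h : (forestCount 3 : ℝ) ≤ 2253061474134434 * 10 ^ 157 := by
    exact_mod_cast forestCount_three_le
  have h0 : 0 < forestCount 3 := by
    obtain ⟨h₀, -⟩ := typeCount_three_eq
    rw [forestCount_eq, h₀]
    omega
  refine (Real.log_le_log (by exact_mod_cast h0) h).trans_lt ?_
  rw [Real.log_lt_iff_lt_exp (by norm_num)]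
  -- The exponent is 396 plus this fraction; a truncated exponential series suffices as a lower
  -- bound.
  have hf := Real.sum_le_exp_of_nonneg (x := 26778935763 / 31250000000) (by norm_num) 14
  rw [show (1.31235755934 * (7 / 5) * 6 ^ 3 : ℝ) =
    (396 : ℕ) * 1 + 26778935763 / 31250000000 by norm_num, Real.exp_add, Real.exp_nat_mul]
  refine lt_of_lt_of_le ?_ (mul_le_mul
    (pow_le_pow_left₀ (by norm_num) exp_one_bounds.1.le 396) hf
    (Finset.sum_nonneg fun i _ => by positivity) (by positivity))
  norm_num [Finset.sum_range_succ, Nat.factorial]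

lemma typeCount_zero_pos (n : ℕ) : 0 < typeCount n 0 := by
  induction n with
  | zero => rw [typeCount_zero_eq.1]; norm_num
  | succ n ih => exact (pow_pos ih 6).trans_le (le_typeCount_succ n)

lemma typeCount_le_forestCount (n : ℕ) : typeCount n 0 ≤ forestCount n := by
  rw [forestCount_eq]; omega

lemma monotone_log_typeCount :
    Monotone fun n : ℕ => Real.log (typeCount n 0) / (6 : ℝ) ^ n := by
  refine monotone_nat_of_le_succ fun n => ?_
  rw [pow_succ, mul_comm, ← div_div, div_le_div_iff_of_pos_right (by positivity),
    le_div_iff₀ (by norm_num), mul_comm]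
  have h : ((typeCount n 0 : ℝ)) ^ 6 ≤ typeCount (n + 1) 0 := by
    exact_mod_cast le_typeCount_succ n
  have h0 : (0 : ℝ) < typeCount n 0 := by exact_mod_cast typeCount_zero_pos n
  simpa [Real.log_pow] using Real.log_le_log (by positivity) h

lemma antitone_log_forestCount :
    Antitone fun n : ℕ => Real.log (forestCount n) / (6 : ℝ) ^ n := by
  refine antitone_nat_of_succ_le fun n => ?_
  rw [pow_succ, mul_comm, ← div_div, div_le_div_iff_of_pos_right (by positivity),
    div_le_iff₀ (by norm_num), mul_comm]
  have h : (forestCount (n + 1) : ℝ) ≤ (forestCount n : ℝ) ^ 6 := by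
    exact_mod_cast forestCount_succ_le n
  have h0 : (0 : ℝ) < forestCount (n + 1) := by
    exact_mod_cast (typeCount_zero_pos _).trans_le (typeCount_le_forestCount _)
  simpa [Real.log_pow] using Real.log_le_log h0 h

/-- By monotonicity both sides can be moved to the common stage `max m n`, where the separated
forests are among all forests. -/
lemma log_typeCount_le_log_forestCount (m n : ℕ) :
    Real.log (typeCount m 0) / (6 : ℝ) ^ m ≤ Real.log (forestCount n) / (6 : ℝ) ^ n := by
  refine (monotone_log_typeCount (le_max_left m n)).trans
    (le_trans ?_ (antitone_log_forestCount (le_max_right m n)))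
  have h0 : (0 : ℝ) < typeCount (max m n) 0 := by exact_mod_cast typeCount_zero_pos _
  have h : (typeCount (max m n) 0 : ℝ) ≤ forestCount (max m n) := by
    exact_mod_cast typeCount_le_forestCount _
  exact div_le_div_of_nonneg_right (Real.log_le_log h0 h) (by positivity)

lemma tendsto_pow_div_card_gasketVerts :
    Filter.Tendsto (fun n : ℕ => (6 : ℝ) ^ n / ((gasketVerts 3 n).card : ℝ)) Filter.atTop
      (nhds (5 / 7)) := by
  have hcard : ∀ n : ℕ, ((gasketVerts 3 n).card : ℝ) = (7 * 6 ^ n + 8) / 5 := by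
    intro n
    have : (5 * (gasketVerts 3 n).card : ℝ) = 7 * 6 ^ n + 8 := by exact_mod_cast card_gasketVerts n
    linarith
  have h1 : Filter.Tendsto (fun n : ℕ => ((6 : ℝ)⁻¹) ^ n) Filter.atTop (nhds 0) :=
    tendsto_pow_atTop_nhds_zero_of_lt_one (by norm_num) (by norm_num)
  have h2 : Filter.Tendsto (fun n : ℕ => 5 / (7 + 8 * ((6 : ℝ)⁻¹) ^ n)) Filter.atTop
      (nhds (5 / (7 + 8 * 0))) :=
    tendsto_const_nhds.div (tendsto_const_nhds.add (h1.const_mul 8)) (by norm_num)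
  rw [mul_zero, add_zero] at h2
  refine h2.congr fun n => ?_
  rw [hcard, inv_pow]
  field_simp

theorem proposition2 :
    ∃ z : ℝ, IsForestGrowthConstant 3 z ∧
      (1.31235755933 : ℝ) ≤ z ∧ z < (1.31235755934 : ℝ) := by
  set u : ℕ → ℝ := fun n => Real.log (forestCount n) / (6 : ℝ) ^ n with hu
  have hbdd : BddBelow (Set.range u) :=
    ⟨_, Set.forall_mem_range.2 fun n => log_typeCount_le_log_forestCount 4 n⟩
  have hlim := tendsto_atTop_ciInf antitone_log_forestCount hbdd
  have hlow : 1.31235755933 * (7 / 5) ≤ ⨅ n, u n :=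
    le_ciInf fun n => le_trans ((le_div_iff₀ (by positivity)).2 log_typeCount_four)
      (log_typeCount_le_log_forestCount 4 n)
  have hup : ⨅ n, u n < 1.31235755934 * (7 / 5) :=
    (ciInf_le hbdd 3).trans_lt ((div_lt_iff₀ (by positivity)).2 log_forestCount_three)
  -- The factor 5 / 7 is the limit of 6 ^ n / v(n), which explains the factor 7 / 5 in the numerical
  -- bounds.
  refine ⟨(⨅ n, u n) * (5 / 7), ?_, by linarith, by linarith⟩
  refine (hlim.mul tendsto_pow_div_card_gasketVerts).congr fun n => ?_
  rw [numSpanningForests_gasket, div_mul_div_cancel₀ (by positivity)]
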